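/- Let $\mathbb H_{\mathbb C}$ be the algebra of biquaternions $q=q_0+\sum_{k=1}^3 q_ke_k$, $q_k\in\mathbb C$ (with $e_k^2=-1$, $e_1e_2=e_3=-e_2e_1$ and cyclically, and complex scalars commuting with the $e_k$), with conjugation $\overline q=q_0-\sum_{k=1}^3q_ke_k$ and norm $|q|=\big(\sum_{k=0}^3|q_k|^2\big)^{1/2}$. Let $G\subset\mathbb R^3$ be a bounded domain, let $a_1,\dots,a_4\in L_\infty(G;\mathbb H_{\mathbb C})$ be arbitrary (no smallness assumption), put $A=(a_1,a_2,a_3,a_4)$ and $$\mathbf Q_Aw=wa_1+\overline w\,a_2+a_3w+a_4\overline w,\qquad \mathbf D=\sum_{k=1}^3e_k\frac{\partial}{\partial x_k}.$$ Let $\tfrac32<p<\infty$. The Vekua–Bergman space $\mathfrak V_A^p(G;\mathbb H_{\mathbb C})$ is the set of all $w\in L_p(G;\mathbb H_{\mathbb C})$ that are weak solutions of $\mathbf Dw-\mathbf Q_Aw=0$ in $G$, that is, $$\int_G\overline w\,(\mathbf D\varphi)\,dx=\int_G\overline{\mathbf Q_Aw}\;\varphi\,dx\qquad\text{for all }\varphi\in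 C_0^\infty(G;\mathbb H_{\mathbb C}).$$ Then every $w\in\mathfrak V_A^p(G;\mathbb H_{\mathbb C})$ has a representative that is continuous on $G$, again denoted by $w$, and for every compact set $K\subset G$ there is a constant $C_K>0$ (independent of $w$) such that $$\max_{x\in K}|w(x)|\le C_K\,\|w\|_{L_p(G;\mathbb H_{\mathbb C})}\qquad\text{for all }w\in\mathfrak V_A^p(G;\mathbb H_{\mathbb C}).$$ -/

import Mathlib

open MeasureTheory
open scoped Quaternion ENNReal ContDiff

noncomputable section

/-! ### Biquaternions

Biquaternions are `ℍ[ℂ]`, Mathlib's quaternion algebra with complex coefficients. Its product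
satisfies `e₁ e₂ = e₃` and `eₖ eₖ = -1`, complex scalars commute with the units, and `star` is the
quaternionic conjugation `p₀ + p⃗ ↦ p₀ - p⃗` (the complex coefficients are not conjugated). -/

/-- The complex-linear map sending a biquaternion to its four components. -/
def biqComponents : ℍ[ℂ] →ₗ[ℂ] EuclideanSpace ℂ (Fin 4) where
  toFun q := !₂[q.re, q.imI, q.imJ, q.imK]
  map_add' p q := by ext i; fin_cases i <;> simp
  map_smul' c q := by ext i; fin_cases i <;> simp

theorem biqComponents_injective : Function.Injective biqComponents := by
  intro p q h
  have h' : ∀ i, biqComponents p i = biqComponents q i := fun i => by rw [h]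
  ext
  · exact h' 0
  · exact h' 1
  · exact h' 2
  · exact h' 3

/-- `ℍ[ℂ]` carries the Hermitian norm of `ℂ⁴`; see `biq_norm_eq`. -/
instance instNormedAddCommGroupBiq : NormedAddCommGroup ℍ[ℂ] :=
  NormedAddCommGroup.induced ℍ[ℂ] (EuclideanSpace ℂ (Fin 4)) biqComponents biqComponents_injective

instance instNormedSpaceBiq : NormedSpace ℂ ℍ[ℂ] :=
  NormedSpace.induced ℂ ℍ[ℂ] (EuclideanSpace ℂ (Fin 4)) biqComponents

/-- The real normed space structure, with componentwise multiplication by real scalars. -/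
instance instRealNormedSpaceBiq : NormedSpace ℝ ℍ[ℂ] :=
  NormedSpace.induced ℝ ℍ[ℂ] (EuclideanSpace ℂ (Fin 4)) (biqComponents.restrictScalars ℝ)

instance instIsScalarTowerBiq : IsScalarTower ℝ ℂ ℍ[ℂ] where
  smul_assoc r c q := by ext <;> simp [mul_assoc]

theorem biq_norm_eq (q : ℍ[ℂ]) :
    ‖q‖ = Real.sqrt (‖q.re‖ ^ 2 + ‖q.imI‖ ^ 2 + ‖q.imJ‖ ^ 2 + ‖q.imK‖ ^ 2) := by
  have h : ‖q‖ = ‖biqComponents q‖ := rfl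
  rw [h, EuclideanSpace.norm_eq]
  simp [Fin.sum_univ_four, biqComponents]

instance instFiniteDimensionalBiq : FiniteDimensional ℂ ℍ[ℂ] :=
  FiniteDimensional.of_injective biqComponents biqComponents_injective

instance instCompleteSpaceBiq : CompleteSpace ℍ[ℂ] :=
  FiniteDimensional.complete ℂ ℍ[ℂ]

/-- The three vector units `e₁, e₂, e₃`. -/
def biqUnit : Fin 3 → ℍ[ℂ] :=
  ![⟨0, 1, 0, 0⟩, ⟨0, 0, 1, 0⟩, ⟨0, 0, 0, 1⟩]

/-! ### The Moisil-Theodorescu operator and the Vekua equation -/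

/-- The Moisil-Theodorescu operator `𝐃 = e₁ ∂₁ + e₂ ∂₂ + e₃ ∂₃` (acting from the left) on a
differentiable function. -/
def diracOp (φ : EuclideanSpace ℝ (Fin 3) → ℍ[ℂ]) (x : EuclideanSpace ℝ (Fin 3)) : ℍ[ℂ] :=
  ∑ k : Fin 3, biqUnit k * fderiv ℝ φ x (EuclideanSpace.single k 1)

/-- `v` is the weak `𝐃`-derivative of `u` on `G`: both are locally integrable on `G`, and
`∫_G ū (𝐃φ) = ∫_G v̄ φ` for every smooth `ℍ[ℂ]`-valued `φ` with compact support in `G`. -/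
def HasWeakDiracDeriv (G : Set (EuclideanSpace ℝ (Fin 3)))
    (u v : EuclideanSpace ℝ (Fin 3) → ℍ[ℂ]) : Prop :=
  LocallyIntegrableOn u G volume ∧ LocallyIntegrableOn v G volume ∧
    ∀ φ : EuclideanSpace ℝ (Fin 3) → ℍ[ℂ],
      ContDiff ℝ ∞ φ → HasCompactSupport φ → tsupport φ ⊆ G →
        ∫ x in G, star (u x) * diracOp φ x = ∫ x in G, star (v x) * φ x

/-- The zero order term `𝐐_A w = w a₁ + w̄ a₂ + a₃ w + a₄ w̄`, with `A = (a₁, a₂, a₃, a₄)` indexed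
by `0, 1, 2, 3`. -/
def vekuaQ (A : Fin 4 → EuclideanSpace ℝ (Fin 3) → ℍ[ℂ])
    (w : EuclideanSpace ℝ (Fin 3) → ℍ[ℂ]) (x : EuclideanSpace ℝ (Fin 3)) : ℍ[ℂ] :=
  w x * A 0 x + star (w x) * A 1 x + A 2 x * w x + A 3 x * star (w x)

/-- The Vekua-Bergman space: the elements `w` of `L_p(G; ℍ[ℂ])` that are weak solutions of
`𝐃 w - 𝐐_A w = 0` in `G`. -/
def vekuaBergman (p : ℝ≥0∞) (G : Set (EuclideanSpace ℝ (Fin 3)))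
    (A : Fin 4 → EuclideanSpace ℝ (Fin 3) → ℍ[ℂ]) : Set (Lp ℍ[ℂ] p (volume.restrict G)) :=
  {w | HasWeakDiracDeriv G w (vekuaQ A w)}

end

open Filter Topology Metric

noncomputable section

/-! ### A smooth truncation of the Cauchy kernel -/

/-! The function `g`, the conjugate of `w` extended by zero, is recovered from its mollifications.
The mollifier is the divergence of a smoothly truncated Cauchy kernel z/|z|³. Two truncations, at
scales ε, δ ≤ R, agree outside the ball of radius R, so their difference is an admissible test
function with pole `x` whenever that ball lies in `G`. Its Dirac image is minus the difference of
the two mollifiers and its size is at most |y - x|⁻². The weak equation and |Q w| ≤ Q |w| therefore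
bound the difference of the two mollifications by a truncated Riesz potential of |g|
(`enorm_mollify_sub_le`).

Letting ε → 0 at Lebesgue points gives |g(x)| ≤ M ∫ |y - x|⁻² |g(y)| dy over the ball of radius R.
No smallness of M is needed. Substituting the inequality into itself weakens the singularity
(`exists_lintegral_rieszKernel_mul_le`), and after three rounds the kernel is bounded. Hence |g| is
locally bounded by its L¹ norm (`exists_ae_enorm_le_lintegral`), which Hölder's inequality on the
bounded set `G` controls by the Lᵖ norm.

With this local bound, the potential over a ball of radius r tends to 0 uniformly as r → 0. The
mollifications are then uniformly Cauchy on compact sets (`uniformCauchySeqOn_mollify`), and their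
limit is the continuous representative up to the factor `mollMass`. -/

/-- The radial profile of a smooth truncation of the kernel `z / ‖z‖ ^ 3`, as a function of
`s = ‖z‖ ^ 2`. -/
def cauchyProfile (s : ℝ) : ℝ := Real.smoothTransition (2 * s - 1) * s ^ (-(3 / 2) : ℝ)

theorem cauchyProfile_of_le_half {s : ℝ} (hs : s ≤ 1 / 2) : cauchyProfile s = 0 := by
  rw [cauchyProfile, Real.smoothTransition.zero_of_nonpos (by linarith), zero_mul]

theorem cauchyProfile_of_one_le {s : ℝ} (hs : 1 ≤ s) :
    cauchyProfile s = s ^ (-(3 / 2) : ℝ) := by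
  rw [cauchyProfile, Real.smoothTransition.one_of_one_le (by linarith), one_mul]

theorem cauchyProfile_nonneg {s : ℝ} (hs : 0 ≤ s) : 0 ≤ cauchyProfile s :=
  mul_nonneg (Real.smoothTransition.nonneg _) (Real.rpow_nonneg hs _)

theorem cauchyProfile_le {s : ℝ} (hs : 0 ≤ s) : cauchyProfile s ≤ s ^ (-(3 / 2) : ℝ) :=
  mul_le_of_le_one_left (Real.rpow_nonneg hs _) (Real.smoothTransition.le_one _)

theorem cauchyProfile_eventuallyEq_zero {s : ℝ} (hs : s < 1 / 2) :
    cauchyProfile =ᶠ[𝓝 s] fun _ => 0 := by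
  filter_upwards [Iio_mem_nhds hs] with t ht using cauchyProfile_of_le_half (le_of_lt ht)

theorem contDiff_cauchyProfile : ContDiff ℝ ∞ cauchyProfile := by
  rw [contDiff_iff_contDiffAt]
  intro s
  rcases lt_or_ge s (1 / 2) with hs | hs
  · exact contDiffAt_const.congr_of_eventuallyEq (cauchyProfile_eventuallyEq_zero hs)
  · have h1 : ContDiffAt ℝ ∞ (fun s : ℝ => Real.smoothTransition (2 * s - 1)) s :=
      (Real.smoothTransition.contDiff (n := ⊤)).contDiffAt.comp s
        ((contDiffAt_const.mul contDiffAt_id).sub contDiffAt_const)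
    exact h1.mul (Real.contDiffAt_rpow_const_of_ne (by linarith))

theorem hasDerivAt_cauchyProfile (s : ℝ) :
    HasDerivAt cauchyProfile (deriv cauchyProfile s) s :=
  ((contDiff_cauchyProfile.differentiable (by simp)) s).hasDerivAt

/-- The radial profile of the divergence of the truncated kernel `cauchyProfile (‖z‖ ^ 2) • z`. -/
def mollProfile (s : ℝ) : ℝ := 3 * cauchyProfile s + 2 * s * deriv cauchyProfile s

theorem continuous_mollProfile : Continuous mollProfile :=
  (continuous_const.mul contDiff_cauchyProfile.continuous).add
    ((continuous_const.mul continuous_id).mul (contDiff_cauchyProfile.continuous_deriv (by simp)))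

/-- The field z/|z|³ is divergence free away from 0, so only the derivative of the cutoff survives.
This makes the mollifier nonnegative and supported in the unit ball. -/
theorem mollProfile_of_pos {s : ℝ} (hs : 0 < s) :
    mollProfile s =
      4 * s ^ (-(1 / 2) : ℝ) * deriv Real.smoothTransition (2 * s - 1) := by
  have hT : HasDerivAt Real.smoothTransition (deriv Real.smoothTransition (2 * s - 1))
      (2 * s - 1) :=
    (((Real.smoothTransition.contDiff (n := 1)).differentiable (by simp)) _).hasDerivAt
  have h1 : HasDerivAt (fun s : ℝ => Real.smoothTransition (2 * s - 1))
      (deriv Real.smoothTransition (2 * s - 1) * (2 * 1)) s :=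
    HasDerivAt.comp (h := fun s : ℝ => 2 * s - 1) s hT
      (((hasDerivAt_id' s).const_mul 2).sub_const 1)
  have h2 := h1.mul (Real.hasDerivAt_rpow_const (p := -(3 / 2)) (Or.inl hs.ne'))
  have h3 : deriv cauchyProfile s = _ := h2.deriv
  rw [mollProfile, h3, cauchyProfile]
  have e1 : s ^ (-(3 / 2) : ℝ) = s ^ (-(1 / 2) : ℝ) / s := by
    rw [← Real.rpow_sub_one hs.ne']; norm_num
  have e2 : s ^ (-(3 / 2) - 1 : ℝ) = s ^ (-(1 / 2) : ℝ) / s / s := by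
    rw [Real.rpow_sub_one hs.ne', e1]
  rw [e2, e1]
  field_simp
  ring

theorem mollProfile_nonneg (s : ℝ) : 0 ≤ mollProfile s := by
  rcases lt_or_ge s (1 / 2) with hs | hs
  · have := cauchyProfile_eventuallyEq_zero hs
    rw [mollProfile, this.deriv_eq, this.eq_of_nhds]
    simp
  · have hs0 : 0 < s := by linarith
    rw [mollProfile_of_pos hs0]
    have := Real.smoothTransition.monotone.deriv_nonneg (x := 2 * s - 1)
    positivity

theorem mollProfile_of_one_lt {s : ℝ} (hs : 1 < s) : mollProfile s = 0 := by
  have hs0 : 0 < s := by linarith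
  have : Real.smoothTransition =ᶠ[𝓝 (2 * s - 1)] fun _ => 1 := by
    filter_upwards [Ioi_mem_nhds (show 1 < 2 * s - 1 by linarith)] with t ht
      using Real.smoothTransition.one_of_one_le (le_of_lt ht)
  rw [mollProfile_of_pos hs0, this.deriv_eq]
  simp

theorem exists_mollProfile_ne_zero : ∃ s : ℝ, 0 ≤ s ∧ mollProfile s ≠ 0 := by
  obtain ⟨c, hc, h⟩ := exists_deriv_eq_slope Real.smoothTransition (zero_lt_one' ℝ)
    Real.smoothTransition.continuous.continuousOn
    (((Real.smoothTransition.contDiff (n := 1)).differentiable (by simp)).differentiableOn)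
  refine ⟨(c + 1) / 2, by linarith [hc.1], ?_⟩
  have hpos : 0 < (c + 1) / 2 := by linarith [hc.1]
  rw [mollProfile_of_pos hpos, show 2 * ((c + 1) / 2) - 1 = c by ring, h]
  simp only [Real.smoothTransition.one, Real.smoothTransition.zero]
  have := Real.rpow_pos_of_pos hpos (-(1 / 2))
  norm_num
  exact this.ne'

/-- The three-dimensional Euclidean space. -/
abbrev Space3 : Type := EuclideanSpace ℝ (Fin 3)

/-- The unnormalised mollifier with radial profile `mollProfile`. -/
def mollKernel (ε : ℝ) (z : Space3) : ℝ := ε⁻¹ ^ 3 * mollProfile (‖z‖ ^ 2 / ε ^ 2)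

/-- The total mass of the mollifiers `mollKernel ε`. -/
def mollMass : ℝ := ∫ z : Space3, mollKernel 1 z

theorem continuous_mollKernel (ε : ℝ) : Continuous (mollKernel ε) :=
  continuous_const.mul (continuous_mollProfile.comp
    ((continuous_norm.pow 2).div_const _))

theorem mollKernel_nonneg {ε : ℝ} (hε : 0 < ε) (z : Space3) : 0 ≤ mollKernel ε z :=
  mul_nonneg (by positivity) (mollProfile_nonneg _)

theorem mollKernel_eq_zero {ε : ℝ} (hε : 0 < ε) {z : Space3} (hz : ε < ‖z‖) :
    mollKernel ε z = 0 := by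
  rw [mollKernel, mollProfile_of_one_lt, mul_zero]
  rw [lt_div_iff₀ (by positivity)]
  nlinarith

theorem hasCompactSupport_mollKernel {ε : ℝ} (hε : 0 < ε) :
    HasCompactSupport (mollKernel ε) :=
  HasCompactSupport.intro (isCompact_closedBall (0 : Space3) ε) fun z hz => by
    exact mollKernel_eq_zero hε (by simpa using hz)

/-- Mollifications converge to `mollMass • g`, so only positivity of the mass is needed, not its
value. -/
theorem mollMass_pos : 0 < mollMass := by
  obtain ⟨s, hs, h⟩ := exists_mollProfile_ne_zero
  refine (continuous_mollKernel 1).integral_pos_of_hasCompactSupport_nonneg_nonzero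
    (hasCompactSupport_mollKernel one_pos) (mollKernel_nonneg one_pos)
    (x := EuclideanSpace.single 0 (Real.sqrt s)) ?_
  simp [mollKernel, Real.sq_sqrt hs, h]

theorem integral_mollKernel {ε : ℝ} (hε : 0 < ε) : ∫ z, mollKernel ε z = mollMass := by
  have h : mollKernel ε = fun z => ε⁻¹ ^ 3 * mollKernel 1 (ε⁻¹ • z) := by
    ext z
    simp only [mollKernel, norm_smul, Real.norm_eq_abs, abs_of_pos (inv_pos.2 hε)]
    congr 2
    · simp
      field_simp
  rw [h, integral_const_mul, Measure.integral_comp_smul, mollMass]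
  simp [abs_of_pos hε]
  field_simp

theorem exists_mollKernel_le : ∃ B : ℝ, 0 < B ∧ ∀ ε : ℝ, 0 < ε → ∀ z : Space3,
    mollKernel ε z ≤ B * ε⁻¹ ^ 3 := by
  obtain ⟨B, hB⟩ := (hasCompactSupport_mollKernel one_pos).exists_bound_of_continuous
    (continuous_mollKernel 1)
  refine ⟨|B| + 1, by positivity, fun ε hε z => ?_⟩
  have h := hB (ε⁻¹ • z)
  have e : mollKernel ε z = ε⁻¹ ^ 3 * mollKernel 1 (ε⁻¹ • z) := by
    simp only [mollKernel, norm_smul, Real.norm_eq_abs, abs_of_pos (inv_pos.2 hε)]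
    congr 2
    · simp
      field_simp
  rw [e, mul_comm]
  gcongr
  calc _ ≤ ‖mollKernel 1 (ε⁻¹ • z)‖ := le_abs_self _
    _ ≤ |B| + 1 := by linarith [le_abs_self B]

/-! ### Test functions with radial profile -/

/-- The embedding of `ℝ³` into the biquaternions as vectors `∑ zₖ eₖ`. -/
def biqVec : Space3 →L[ℝ] ℍ[ℂ] :=
  LinearMap.toContinuousLinearMap
    { toFun := fun z => ∑ k : Fin 3, z k • biqUnit k
      map_add' := fun a b => by simp [add_smul, Finset.sum_add_distrib]
      map_smul' := fun r a => by simp [mul_smul, Finset.smul_sum] }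

theorem biqUnit_re (k : Fin 3) : (biqUnit k).re = 0 := by fin_cases k <;> rfl

theorem biqUnit_imI (k : Fin 3) : (biqUnit k).imI = if k = 0 then 1 else 0 := by
  fin_cases k <;> simp [biqUnit]

theorem biqUnit_imJ (k : Fin 3) : (biqUnit k).imJ = if k = 1 then 1 else 0 := by
  fin_cases k <;> simp [biqUnit]

theorem biqUnit_imK (k : Fin 3) : (biqUnit k).imK = if k = 2 then 1 else 0 := by
  fin_cases k <;> simp [biqUnit]

theorem biqVec_apply (z : Space3) : biqVec z = ∑ k : Fin 3, z k • biqUnit k := rfl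

theorem biqVec_re (z : Space3) : (biqVec z).re = 0 := by
  simp [biqVec_apply, Fin.sum_univ_three, biqUnit_re]

theorem biqVec_imI (z : Space3) : (biqVec z).imI = z 0 := by
  simp [biqVec_apply, Fin.sum_univ_three, biqUnit_imI]

theorem biqVec_imJ (z : Space3) : (biqVec z).imJ = z 1 := by
  simp [biqVec_apply, Fin.sum_univ_three, biqUnit_imJ]

theorem biqVec_imK (z : Space3) : (biqVec z).imK = z 2 := by
  simp [biqVec_apply, Fin.sum_univ_three, biqUnit_imK]

theorem biqVec_single (k : Fin 3) : biqVec (EuclideanSpace.single k 1) = biqUnit k := by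
  rw [biqVec_apply]
  fin_cases k <;> simp

theorem norm_biqVec (z : Space3) : ‖biqVec z‖ = ‖z‖ := by
  rw [biq_norm_eq, EuclideanSpace.norm_eq, Fin.sum_univ_three]
  simp [biqVec_re, biqVec_imI, biqVec_imJ, biqVec_imK]

/-- Both terms are real scalars: each unit squares to -1, and a real vector squares to minus its
squared length. -/
theorem sum_biqUnit_mul (a b : ℝ) (z : Space3) :
    ∑ k : Fin 3, biqUnit k * (a • biqUnit k + (b * z k) • biqVec z) =
      -((3 * a + b * ‖z‖ ^ 2) • (1 : ℍ[ℂ])) := by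
  rw [EuclideanSpace.real_norm_sq_eq, Fin.sum_univ_three, Fin.sum_univ_three]
  ext <;> simp [biqUnit_re, biqUnit_imI, biqUnit_imJ, biqUnit_imK, biqVec_re, biqVec_imI,
    biqVec_imJ, biqVec_imK] <;> ring

/-- On vector fields the operator is -div + curl; a radial field has no curl, which leaves minus the
divergence. -/
theorem diracOp_radial {h : ℝ → ℝ} {h' : ℝ} (x y : Space3)
    (hh : HasDerivAt h h' (‖y - x‖ ^ 2)) :
    diracOp (fun y => h (‖y - x‖ ^ 2) • biqVec (y - x)) y =
      -((3 * h (‖y - x‖ ^ 2) + 2 * ‖y - x‖ ^ 2 * h') • (1 : ℍ[ℂ])) := by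
  have h0 : HasFDerivAt (fun y : Space3 => y - x) (ContinuousLinearMap.id ℝ Space3) y :=
    (hasFDerivAt_id y).sub_const x
  have h1 := hh.comp_hasFDerivAt y h0.norm_sq
  have h2 := h1.smul (biqVec.hasFDerivAt.comp y h0)
  have h3 : fderiv ℝ (fun y => h (‖y - x‖ ^ 2) • biqVec (y - x)) y = _ := h2.fderiv
  rw [diracOp, h3, show 3 * h (‖y - x‖ ^ 2) + 2 * ‖y - x‖ ^ 2 * h' =
    3 * h (‖y - x‖ ^ 2) + (2 * h') * ‖y - x‖ ^ 2 by ring, ← sum_biqUnit_mul]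
  refine Finset.sum_congr rfl fun k _ => ?_
  congr 1
  simp [biqVec_single, EuclideanSpace.inner_single_right]
  congr 1
  ring

/-! ### Differences of truncated Cauchy kernels as test functions -/

/-- The profile `cauchyProfile` at scale `ε`. -/
def scaledProfile (ε s : ℝ) : ℝ := ε⁻¹ ^ 3 * cauchyProfile (s / ε ^ 2)

theorem contDiff_scaledProfile (ε : ℝ) : ContDiff ℝ ∞ (scaledProfile ε) :=
  contDiff_const.mul (contDiff_cauchyProfile.comp (contDiff_id.div_const _))

theorem hasDerivAt_scaledProfile (ε s : ℝ) :
    HasDerivAt (scaledProfile ε)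
      (ε⁻¹ ^ 3 * (deriv cauchyProfile (s / ε ^ 2) * (1 / ε ^ 2))) s :=
  (HasDerivAt.comp (h := fun s : ℝ => s / ε ^ 2) s (hasDerivAt_cauchyProfile _)
    ((hasDerivAt_id' s).div_const _)).const_mul _

/-- Homogeneity makes the rescaled truncations coincide with one and the same Cauchy kernel away
from the pole, so their differences have compact support. -/
theorem rpow_scale {ε s : ℝ} (hε : 0 < ε) (hs : 0 ≤ s) :
    ε⁻¹ ^ 3 * (s / ε ^ 2) ^ (-(3 / 2) : ℝ) = s ^ (-(3 / 2) : ℝ) := by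
  have h : (ε ^ 2) ^ (-(3 / 2) : ℝ) = ε⁻¹ ^ 3 := by
    rw [← Real.rpow_natCast, ← Real.rpow_mul hε.le, inv_pow, ← Real.rpow_natCast ε 3,
      ← Real.rpow_neg hε.le]
    norm_num
  rw [Real.div_rpow hs (by positivity), h]
  field_simp

theorem scaledProfile_nonneg {ε s : ℝ} (hε : 0 < ε) (hs : 0 ≤ s) : 0 ≤ scaledProfile ε s :=
  mul_nonneg (by positivity) (cauchyProfile_nonneg (by positivity))

theorem scaledProfile_le {ε s : ℝ} (hε : 0 < ε) (hs : 0 ≤ s) :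
    scaledProfile ε s ≤ s ^ (-(3 / 2) : ℝ) := by
  rw [← rpow_scale hε hs]
  exact mul_le_mul_of_nonneg_left (cauchyProfile_le (by positivity)) (by positivity)

theorem scaledProfile_of_le {ε s : ℝ} (hε : 0 < ε) (hs : ε ^ 2 ≤ s) :
    scaledProfile ε s = s ^ (-(3 / 2) : ℝ) := by
  have h0 : 0 ≤ s := le_trans (by positivity) hs
  rw [← rpow_scale hε h0, scaledProfile, cauchyProfile_of_one_le]
  rwa [le_div_iff₀ (by positivity), one_mul]

/-- The difference of two truncated Cauchy kernels with pole `x`; it is smooth and compactly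
supported. -/
def cauchyTest (ε δ : ℝ) (x y : Space3) : ℍ[ℂ] :=
  (scaledProfile ε (‖y - x‖ ^ 2) - scaledProfile δ (‖y - x‖ ^ 2)) • biqVec (y - x)

theorem contDiff_cauchyTest (ε δ : ℝ) (x : Space3) : ContDiff ℝ ∞ (cauchyTest ε δ x) := by
  have h0 : ContDiff ℝ ∞ fun y : Space3 => y - x := contDiff_id.sub contDiff_const
  exact (((contDiff_scaledProfile ε).comp (h0.norm_sq ℝ)).sub
    ((contDiff_scaledProfile δ).comp (h0.norm_sq ℝ))).smul (biqVec.contDiff.comp h0)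

theorem diracOp_cauchyTest (ε δ : ℝ) (x y : Space3) :
    diracOp (cauchyTest ε δ x) y =
      -((mollKernel ε (y - x) - mollKernel δ (y - x)) • (1 : ℍ[ℂ])) := by
  have h := diracOp_radial x y
    ((hasDerivAt_scaledProfile ε (‖y - x‖ ^ 2)).sub (hasDerivAt_scaledProfile δ (‖y - x‖ ^ 2)))
  refine Eq.trans h ?_
  congr 2
  simp only [mollKernel, mollProfile, scaledProfile, Pi.sub_apply]
  ring

theorem cauchyTest_eq_zero {ε δ R : ℝ} (hε : 0 < ε) (hδ : 0 < δ) (hεR : ε ≤ R) (hδR : δ ≤ R)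
    {x y : Space3} (hy : R ≤ ‖y - x‖) : cauchyTest ε δ x y = 0 := by
  rw [cauchyTest, scaledProfile_of_le hε (by nlinarith), scaledProfile_of_le hδ (by nlinarith),
    sub_self, zero_smul]

theorem tsupport_cauchyTest {ε δ R : ℝ} (hε : 0 < ε) (hδ : 0 < δ) (hεR : ε ≤ R) (hδR : δ ≤ R)
    (x : Space3) : tsupport (cauchyTest ε δ x) ⊆ closedBall x R := by
  refine closure_minimal (fun y hy => ?_) isClosed_closedBall
  by_contra hn
  rw [mem_closedBall, dist_eq_norm, not_le] at hn
  exact hy (cauchyTest_eq_zero hε hδ hεR hδR hn.le)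

theorem hasCompactSupport_cauchyTest {ε δ : ℝ} (hε : 0 < ε) (hδ : 0 < δ) (x : Space3) :
    HasCompactSupport (cauchyTest ε δ x) :=
  (isCompact_closedBall x (max ε δ)).of_isClosed_subset (isClosed_tsupport _)
    (tsupport_cauchyTest hε hδ (le_max_left _ _) (le_max_right _ _) x)

theorem enorm_cauchyTest_le {ε δ R : ℝ} (hε : 0 < ε) (hδ : 0 < δ) (hεR : ε ≤ R) (hδR : δ ≤ R)
    (x y : Space3) :
    ‖cauchyTest ε δ x y‖ₑ ≤
      (closedBall x R).indicator (fun y => ‖y - x‖ₑ ^ (-2 : ℝ)) y := by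
  rcases lt_or_ge R ‖y - x‖ with hy | hy
  · rw [cauchyTest_eq_zero hε hδ hεR hδR hy.le]
    simp
  rw [Set.indicator_of_mem (by rwa [mem_closedBall, dist_eq_norm])]
  rcases eq_or_ne (y - x) 0 with h0 | h0
  · simp [cauchyTest, h0]
  have hpos : 0 < ‖y - x‖ := norm_pos_iff.2 h0
  rw [← ofReal_norm, ← ofReal_norm, ENNReal.ofReal_rpow_of_pos hpos]
  refine ENNReal.ofReal_le_ofReal ?_
  rw [cauchyTest, norm_smul, norm_biqVec]
  have hs : (0 : ℝ) ≤ ‖y - x‖ ^ 2 := by positivity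
  -- Both profiles lie between 0 and s^(-3/2), hence so does their distance; the bound is uniform in
  -- ε and δ.
  have h1 : ‖scaledProfile ε (‖y - x‖ ^ 2) - scaledProfile δ (‖y - x‖ ^ 2)‖ ≤
      (‖y - x‖ ^ 2) ^ (-(3 / 2) : ℝ) := by
    rw [Real.norm_eq_abs, abs_sub_le_iff]
    constructor <;> linarith [scaledProfile_nonneg hε hs, scaledProfile_nonneg hδ hs,
      scaledProfile_le hε hs, scaledProfile_le hδ hs]
  refine (mul_le_mul_of_nonneg_right h1 hpos.le).trans_eq ?_
  rw [← Real.rpow_natCast, ← Real.rpow_mul hpos.le, ← Real.rpow_add_one hpos.ne']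
  norm_num

/-! ### Multiplication and conjugation of biquaternions -/

/-- Multiplication of biquaternions as a continuous bilinear map. -/
def biqMul : ℍ[ℂ] →L[ℂ] ℍ[ℂ] →L[ℂ] ℍ[ℂ] :=
  LinearMap.toContinuousLinearMap
    ((LinearMap.toContinuousLinearMap (E := ℍ[ℂ]) (F' := ℍ[ℂ]) (𝕜 := ℂ)).toLinearMap ∘ₗ
      LinearMap.mk₂ ℂ (fun p q : ℍ[ℂ] => p * q)
        (fun _ _ _ => by ext <;> simp <;> ring) (fun _ _ _ => by ext <;> simp <;> ring)
        (fun _ _ _ => by ext <;> simp <;> ring) (fun _ _ _ => by ext <;> simp <;> ring))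

/-- The Hermitian norm is not submultiplicative on biquaternions, so the norm of the product map
enters as a constant. -/
theorem enorm_biq_mul_le (p q : ℍ[ℂ]) : ‖p * q‖ₑ ≤ ‖biqMul‖ₑ * ‖p‖ₑ * ‖q‖ₑ := by
  have h : ‖p * q‖ ≤ ‖biqMul‖ * ‖p‖ * ‖q‖ := biqMul.le_opNorm₂ p q
  simp only [← ofReal_norm]
  rw [← ENNReal.ofReal_mul (by positivity), ← ENNReal.ofReal_mul (by positivity)]
  exact ENNReal.ofReal_le_ofReal h

theorem norm_biq_star (q : ℍ[ℂ]) : ‖star q‖ = ‖q‖ := by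
  simp [biq_norm_eq]

/-- Conjugation of biquaternions as a real-linear isometry. -/
def biqStar : ℍ[ℂ] →ₗᵢ[ℝ] ℍ[ℂ] where
  toFun := star
  map_add' p q := by ext <;> simp <;> ring
  map_smul' r q := by ext <;> simp
  norm_map' := norm_biq_star

theorem enorm_biq_star (q : ℍ[ℂ]) : ‖star q‖ₑ = ‖q‖ₑ := by
  simp only [← ofReal_norm, norm_biq_star]

/-- The estimates use the zero order term only through this pointwise bound, which is insensitive to
the order of factors and to conjugation. -/
theorem enorm_vekuaQ_le {G : Set Space3} (A : Fin 4 → Space3 → ℍ[ℂ]) (w : Space3 → ℍ[ℂ]) :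
    ∀ᵐ x ∂volume.restrict G, ‖vekuaQ A w x‖ₑ ≤
      (‖biqMul‖ₑ * ∑ j, eLpNorm (A j) ⊤ (volume.restrict G)) * ‖w x‖ₑ := by
  have h : ∀ᵐ x ∂volume.restrict G, ∀ j, ‖A j x‖ₑ ≤ eLpNorm (A j) ⊤ (volume.restrict G) :=
    ae_all_iff.2 fun j => by
      simpa only [eLpNorm_exponent_top] using enorm_ae_le_eLpNormEssSup (A j) _
  filter_upwards [h] with x hx
  have e : ∀ j, ∀ q : ℍ[ℂ], ‖q‖ₑ = ‖w x‖ₑ → ‖q * A j x‖ₑ ≤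
      ‖biqMul‖ₑ * eLpNorm (A j) ⊤ (volume.restrict G) * ‖w x‖ₑ := fun j q hq => by
    refine (enorm_biq_mul_le _ _).trans ?_
    rw [hq, mul_assoc, mul_assoc, mul_comm ‖w x‖ₑ]
    gcongr
    exact hx j
  have e' : ∀ j, ∀ q : ℍ[ℂ], ‖q‖ₑ = ‖w x‖ₑ → ‖A j x * q‖ₑ ≤
      ‖biqMul‖ₑ * eLpNorm (A j) ⊤ (volume.restrict G) * ‖w x‖ₑ := fun j q hq => by
    refine (enorm_biq_mul_le _ _).trans ?_
    rw [hq]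
    gcongr
    exact hx j
  rw [Fin.sum_univ_four, mul_add, mul_add, mul_add, add_mul, add_mul, add_mul]
  refine (enorm_add_le _ _).trans (add_le_add ((enorm_add_le _ _).trans (add_le_add
    ((enorm_add_le _ _).trans (add_le_add ?_ ?_)) ?_)) ?_)
  · exact e 0 _ rfl
  · exact e 1 _ (enorm_biq_star _)
  · exact e' 2 _ rfl
  · exact e' 3 _ (enorm_biq_star _)

theorem biq_mul_neg_real_smul_one (p : ℍ[ℂ]) (r : ℝ) : p * -(r • (1 : ℍ[ℂ])) = -(r • p) := by
  ext <;> simp [mul_comm]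

/-! ### Mollification -/

section Mollify

variable {E : Type*} [NormedAddCommGroup E] [NormedSpace ℝ E]

/-- The unnormalised mollification of `g` at scale `ε`. -/
def mollify (ε : ℝ) (g : Space3 → E) (x : Space3) : E := ∫ y, mollKernel ε (y - x) • g y

theorem exists_norm_mollKernel_le {ε : ℝ} (hε : 0 < ε) :
    ∃ B : ℝ, ∀ z, ‖mollKernel ε z‖ ≤ B :=
  (hasCompactSupport_mollKernel hε).exists_bound_of_continuous (continuous_mollKernel ε)

theorem integrable_mollKernel_smul {ε : ℝ} (hε : 0 < ε) {g : Space3 → E} (hg : Integrable g)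
    (x : Space3) : Integrable fun y => mollKernel ε (y - x) • g y := by
  obtain ⟨B, hB⟩ := exists_norm_mollKernel_le hε
  exact hg.bdd_smul B ((continuous_mollKernel ε).comp
    (continuous_id.sub continuous_const)).aestronglyMeasurable (ae_of_all _ fun y => hB _)

theorem continuous_mollify {ε : ℝ} (hε : 0 < ε) {g : Space3 → E} (hg : Integrable g) :
    Continuous (mollify ε g) := by
  obtain ⟨B, hB⟩ := exists_norm_mollKernel_le hε
  refine continuous_of_dominated (bound := fun y => B * ‖g y‖)
    (fun x => (integrable_mollKernel_smul hε hg x).aestronglyMeasurable)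
    (fun x => ae_of_all _ fun y => ?_) (hg.norm.const_mul B) (ae_of_all _ fun y => ?_)
  · rw [norm_smul]
    exact mul_le_mul_of_nonneg_right (hB _) (norm_nonneg _)
  · exact ((continuous_mollKernel ε).comp (continuous_const.sub continuous_id)).smul
      continuous_const

/-- On the ball, 1 ≤ R² |y - x|⁻², so the mollification at the fixed scale `R` is absorbed into the
same Riesz potential that controls the differences. -/
theorem exists_enorm_mollify_le {R : ℝ} (hR : 0 < R) : ∃ B : ℝ≥0∞, B ≠ ⊤ ∧
    ∀ (g : Space3 → E) (x : Space3), ‖mollify R g x‖ₑ ≤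
      B * ∫⁻ y in closedBall x R, ‖y - x‖ₑ ^ (-2 : ℝ) * ‖g y‖ₑ := by
  obtain ⟨B, hB⟩ := exists_norm_mollKernel_le hR
  refine ⟨ENNReal.ofReal B * ENNReal.ofReal R ^ (2 : ℝ),
    ENNReal.mul_ne_top (by simp) (by simp), fun g x => ?_⟩
  calc ‖mollify R g x‖ₑ ≤ ∫⁻ y, ‖mollKernel R (y - x) • g y‖ₑ := enorm_integral_le_lintegral_enorm _
    _ = ∫⁻ y in closedBall x R, ‖mollKernel R (y - x) • g y‖ₑ := by
        rw [← lintegral_indicator measurableSet_closedBall]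
        refine lintegral_congr fun y => ?_
        by_cases hy : y ∈ closedBall x R
        · rw [Set.indicator_of_mem hy]
        · rw [Set.indicator_of_notMem hy, mollKernel_eq_zero hR, zero_smul, enorm_zero]
          simpa [dist_eq_norm] using hy
    _ ≤ ∫⁻ y in closedBall x R, (ENNReal.ofReal B * ENNReal.ofReal R ^ (2 : ℝ)) *
          (‖y - x‖ₑ ^ (-2 : ℝ) * ‖g y‖ₑ) := by
        refine setLIntegral_mono' measurableSet_closedBall fun y hy => ?_
        rw [enorm_smul, mul_assoc, ← mul_assoc (ENNReal.ofReal R ^ (2 : ℝ))]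
        have h1 : ‖mollKernel R (y - x)‖ₑ ≤ ENNReal.ofReal B := by
          rw [← ofReal_norm]
          exact ENNReal.ofReal_le_ofReal (hB _)
        have h2 : ‖y - x‖ₑ ≤ ENNReal.ofReal R := by
          rw [← ofReal_norm]
          exact ENNReal.ofReal_le_ofReal (by simpa [dist_eq_norm] using hy)
        have h3 : 1 ≤ ENNReal.ofReal R ^ (2 : ℝ) * ‖y - x‖ₑ ^ (-2 : ℝ) := by
          rw [ENNReal.rpow_neg, ← div_eq_mul_inv, ← ENNReal.div_rpow_of_nonneg _ _ (by norm_num)]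
          refine ENNReal.one_le_rpow ?_ (by norm_num)
          rw [ENNReal.le_div_iff_mul_le (Or.inr (by simpa using hR)) (Or.inl enorm_ne_top), one_mul]
          exact h2
        calc ‖mollKernel R (y - x)‖ₑ * ‖g y‖ₑ ≤ ENNReal.ofReal B * (1 * ‖g y‖ₑ) := by
              rw [one_mul]; gcongr
          _ ≤ _ := by gcongr
    _ = _ := lintegral_const_mul' _ _ (ENNReal.mul_ne_top (by simp) (by simp))

theorem mollify_sub_smul {ε : ℝ} (hε : 0 < ε) {g : Space3 → E} (hg : Integrable g)
    [CompleteSpace E] (x : Space3) :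
    mollify ε g x - mollMass • g x = ∫ y, mollKernel ε (y - x) • (g y - g x) := by
  have hk : Integrable (mollKernel ε) :=
    (continuous_mollKernel ε).integrable_of_hasCompactSupport (hasCompactSupport_mollKernel hε)
  have e : mollMass • g x = ∫ y, mollKernel ε (y - x) • g x := by
    rw [integral_smul_const, integral_sub_right_eq_self (mollKernel ε), integral_mollKernel hε]
  rw [e, mollify, ← integral_sub (integrable_mollKernel_smul hε hg x)
    ((hk.comp_sub_right x).smul_const _)]
  simp only [smul_sub]

/-- Mollifications converge at almost every point. -/
theorem ae_tendsto_mollify [CompleteSpace E] {g : Space3 → E} (hg : Integrable g) :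
    ∀ᵐ x, Tendsto (fun ε => mollify ε g x) (𝓝[>] 0) (𝓝 (mollMass • g x)) := by
  obtain ⟨B, hB0, hB⟩ := exists_mollKernel_le
  filter_upwards [IsUnifLocDoublingMeasure.ae_tendsto_average_norm_sub volume
    -- At a Lebesgue point the mean oscillation over the ball of radius ε tends to 0. The mollifier
    -- is at most B ε⁻³ there and the ball has volume V ε³, so the error is at most B V times that
    -- mean.
    hg.locallyIntegrable 1] with x hx
  have h := hx (fun _ : ℝ => x) (fun ε => ε) tendsto_id (by
    filter_upwards [self_mem_nhdsWithin] with ε hε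
    exact mem_closedBall_self (by simpa using le_of_lt hε))
  set V : ℝ := volume.real (closedBall (0 : Space3) 1) with hV
  have h' := h.const_mul (B * V)
  rw [mul_zero] at h'
  rw [tendsto_iff_norm_sub_tendsto_zero]
  refine squeeze_zero' (Eventually.of_forall fun _ => norm_nonneg _) ?_ h'
  filter_upwards [self_mem_nhdsWithin] with ε (hε : 0 < ε)
  have hint : IntegrableOn (fun y => ‖g y - g x‖) (closedBall x ε) :=
    (hg.integrableOn.sub (integrableOn_const measure_closedBall_lt_top.ne)).norm
  rw [mollify_sub_smul hε hg]
  calc ‖∫ y, mollKernel ε (y - x) • (g y - g x)‖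
      = ‖∫ y in closedBall x ε, mollKernel ε (y - x) • (g y - g x)‖ := by
        rw [setIntegral_eq_integral_of_forall_compl_eq_zero]
        intro y hy
        rw [mollKernel_eq_zero hε, zero_smul]
        simpa [dist_eq_norm] using hy
    _ ≤ ∫ y in closedBall x ε, B * ε⁻¹ ^ 3 * ‖g y - g x‖ := by
        refine norm_integral_le_of_norm_le (hint.const_mul _) (ae_of_all _ fun y => ?_)
        rw [norm_smul, Real.norm_of_nonneg (mollKernel_nonneg hε _)]
        exact mul_le_mul_of_nonneg_right (hB ε hε _) (norm_nonneg _)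
    _ = _ := by
        rw [integral_const_mul, setAverage_eq, smul_eq_mul, measureReal_def,
          Measure.addHaar_closedBall' _ _ hε.le, ENNReal.toReal_mul, ← measureReal_def, ← hV]
        have hV0 : V ≠ 0 := (ENNReal.toReal_pos
          (measure_closedBall_pos _ _ one_pos).ne' measure_closedBall_lt_top.ne).ne'
        rw [ENNReal.toReal_ofReal (by positivity)]
        simp only [finrank_euclideanSpace, Fintype.card_fin]
        field_simp

end Mollify

/-! ### The weak equation tested against Cauchy kernels -/

theorem enorm_mollify_sub_le {G : Set Space3} {w v : Space3 → ℍ[ℂ]} (hG : MeasurableSet G)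
    (h : HasWeakDiracDeriv G w v) (hw : IntegrableOn w G) {Q : ℝ≥0∞} (hQ : Q ≠ ⊤)
    (hv : ∀ᵐ x ∂volume.restrict G, ‖v x‖ₑ ≤ Q * ‖w x‖ₑ) {ε δ R : ℝ} (hε : 0 < ε) (hδ : 0 < δ)
    (hεR : ε ≤ R) (hδR : δ ≤ R) {x : Space3} (hx : closedBall x R ⊆ G) :
    ‖mollify ε (G.indicator fun y => star (w y)) x -
        mollify δ (G.indicator fun y => star (w y)) x‖ₑ ≤
      (‖biqMul‖ₑ * Q) * ∫⁻ y in closedBall x R, ‖y - x‖ₑ ^ (-2 : ℝ) *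
        ‖G.indicator (fun y => star (w y)) y‖ₑ := by
  set g := G.indicator fun y => star (w y) with hg
  have hgi : Integrable g :=
    (integrable_indicator_iff hG).2 (biqStar.toContinuousLinearMap.integrable_comp hw)
  have hweak := h.2.2 _ (contDiff_cauchyTest ε δ x) (hasCompactSupport_cauchyTest hε hδ x)
    ((tsupport_cauchyTest hε hδ hεR hδR x).trans hx)
  have hlhs : ∫ y in G, star (w y) * diracOp (cauchyTest ε δ x) y =
      -(mollify ε g x - mollify δ g x) := by
    rw [mollify, mollify, ← integral_sub (integrable_mollKernel_smul hε hgi x)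
      (integrable_mollKernel_smul hδ hgi x), ← integral_neg, ← integral_indicator hG]
    refine integral_congr_ae (ae_of_all _ fun y => ?_)
    by_cases hy : y ∈ G
    · simp only [hg, Set.indicator_of_mem hy, diracOp_cauchyTest, ← sub_smul]
      rw [biq_mul_neg_real_smul_one]
    · simp only [hg, Set.indicator_of_notMem hy, smul_zero, sub_zero, neg_zero]
  rw [← enorm_neg, ← hlhs, hweak]
  calc ‖∫ y in G, star (v y) * cauchyTest ε δ x y‖ₑ
      ≤ ∫⁻ y in G, ‖star (v y) * cauchyTest ε δ x y‖ₑ := enorm_integral_le_lintegral_enorm _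
    _ ≤ ∫⁻ y in G, (‖biqMul‖ₑ * Q) * (closedBall x R).indicator
          (fun y => ‖y - x‖ₑ ^ (-2 : ℝ) * ‖g y‖ₑ) y := by
        refine lintegral_mono_ae ?_
        filter_upwards [hv, ae_restrict_mem hG] with y hy hyG
        have h1 := enorm_cauchyTest_le hε hδ hεR hδR x y
        refine (enorm_biq_mul_le _ _).trans ?_
        rw [enorm_biq_star]
        by_cases hyB : y ∈ closedBall x R
        · rw [Set.indicator_of_mem hyB] at h1 ⊢
          rw [hg, Set.indicator_of_mem hyG, enorm_biq_star]
          calc _ ≤ ‖biqMul‖ₑ * (Q * ‖w y‖ₑ) * ‖y - x‖ₑ ^ (-2 : ℝ) := by gcongr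
            _ = _ := by ring
        · rw [Set.indicator_of_notMem hyB] at h1
          simp [le_antisymm h1 zero_le]
    _ = (‖biqMul‖ₑ * Q) * ∫⁻ y in G, (closedBall x R).indicator
          (fun y => ‖y - x‖ₑ ^ (-2 : ℝ) * ‖g y‖ₑ) y :=
        lintegral_const_mul' _ _ (ENNReal.mul_ne_top enorm_ne_top hQ)
    _ ≤ _ := by
        rw [← lintegral_indicator measurableSet_closedBall]
        exact mul_le_mul_right (setLIntegral_le_lintegral _ _) _

/-! ### Truncated Riesz kernels -/

/-- The kernel `‖z‖ ^ (-α)` truncated to the ball of radius `R`. -/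
def rieszKernel (R α : ℝ) : Space3 → ℝ≥0∞ :=
  (closedBall 0 R).indicator fun z => ‖z‖ₑ ^ (-α)

theorem rieszKernel_of_le {R α : ℝ} {z : Space3} (hz : ‖z‖ ≤ R) :
    rieszKernel R α z = ‖z‖ₑ ^ (-α) :=
  Set.indicator_of_mem (by simpa using hz) _

theorem rieszKernel_of_lt {R α : ℝ} {z : Space3} (hz : R < ‖z‖) : rieszKernel R α z = 0 :=
  Set.indicator_of_notMem (by simpa using hz) _

theorem measurable_rieszKernel (R α : ℝ) : Measurable (rieszKernel R α) :=
  (measurable_enorm.pow_const _).indicator measurableSet_closedBall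

theorem lintegral_rieszKernel_lt_top {α : ℝ} (hα : α < 3) (R : ℝ) :
    ∫⁻ z, rieszKernel R α z < ⊤ := by
  have hi : IntegrableOn (fun z : Space3 => ‖z‖ ^ (-α)) (ball 0 (R + 1)) :=
    integrableOn_ball_of_norm_le_rpow (C := 1) (α := α) (by simp) (by simpa using hα)
      (ae_of_all _ fun z => by
        rw [one_mul, Real.norm_of_nonneg (Real.rpow_nonneg (norm_nonneg z) _)])
      (measurable_norm.pow_const _).aestronglyMeasurable
  refine lt_of_le_of_lt ?_ hi.lintegral_lt_top
  rw [rieszKernel, lintegral_indicator measurableSet_closedBall]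
  refine (lintegral_mono_ae ?_).trans
    (lintegral_mono_set (closedBall_subset_ball (lt_add_one R)))
  -- For α > 0 the real power is 0 at the origin while the extended one is ⊤; the origin is a null
  -- set.
  have h0 : ∀ᵐ z : Space3, z ≠ 0 := by simp [ae_iff, measure_singleton]
  filter_upwards [ae_restrict_of_ae h0] with z hz
  rw [← ofReal_norm, ENNReal.ofReal_rpow_of_pos (norm_pos_iff.2 hz)]

theorem setLIntegral_closedBall_eq_rieszKernel (R α : ℝ) (f : Space3 → ℝ≥0∞) (x : Space3) :
    ∫⁻ y in closedBall x R, ‖y - x‖ₑ ^ (-α) * f y = ∫⁻ y, rieszKernel R α (y - x) * f y := by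
  rw [← lintegral_indicator measurableSet_closedBall]
  refine lintegral_congr fun y => ?_
  by_cases hy : ‖y - x‖ ≤ R
  · rw [Set.indicator_of_mem (by simpa [dist_eq_norm] using hy), rieszKernel_of_le hy]
  · rw [Set.indicator_of_notMem (by simpa [dist_eq_norm] using hy),
      rieszKernel_of_lt (not_le.1 hy), zero_mul]

/-- Split b^(-β) as b^(-s) b^(-(β-s)), then lower the first base to t and the second to a. The zero
cases are separate because 0 · ⊤ = 0. -/
theorem ENNReal.rpow_neg_mul_rpow_neg_le {a b t : ℝ≥0∞} (ht : t ≤ b) (hab : a ≤ b)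
    (hb : b ≠ ⊤) {α β s : ℝ} (hα : 0 ≤ α) (hs : 0 ≤ s)
    (hsβ : s ≤ β) :
    a ^ (-α) * b ^ (-β) ≤ t ^ (-s) * a ^ (-(α + β - s)) := by
  have hat : a ≠ ⊤ := ne_top_of_le_ne_top hb hab
  have htt : t ≠ ⊤ := ne_top_of_le_ne_top hb ht
  have anti : ∀ {u v : ℝ≥0∞} {r : ℝ}, 0 ≤ r → u ≤ v → v ^ (-r) ≤ u ^ (-r) := fun hr huv => by
    rw [ENNReal.rpow_neg, ENNReal.rpow_neg, ENNReal.inv_le_inv]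
    exact ENNReal.rpow_le_rpow huv hr
  rcases eq_or_ne b 0 with rfl | hb0
  · obtain rfl : a = 0 := le_antisymm hab zero_le
    obtain rfl : t = 0 := le_antisymm ht zero_le
    have hne : ∀ {r : ℝ}, 0 ≤ r → (0 : ℝ≥0∞) ^ (-r) ≠ 0 := fun hr => by
      rw [ENNReal.rpow_neg, ENNReal.inv_ne_zero]
      exact ENNReal.rpow_ne_top_of_nonneg hr (by simp)
    rcases (show 0 ≤ α + β - s by linarith).eq_or_lt with h | h
    · obtain rfl : s = β := by linarith
      obtain rfl : α = 0 := by linarith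
      simp
    · rw [ENNReal.zero_rpow_of_neg (by linarith : -(α + β - s) < 0), ENNReal.mul_top (hne hs)]
      exact le_top
  have e : b ^ (-β) = b ^ (-s) * b ^ (-(β - s)) := by
    rw [← ENNReal.rpow_add _ _ hb0 hb]
    congr 1
    ring
  rcases eq_or_ne a 0 with rfl | ha0
  · have hts : t ^ (-s) ≠ 0 := by
      rw [ENNReal.rpow_neg, ENNReal.inv_ne_zero]
      exact ENNReal.rpow_ne_top_of_nonneg hs htt
    rcases hα.eq_or_lt with rfl | hα
    · rw [neg_zero, ENNReal.rpow_zero, one_mul, e, zero_add]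
      exact mul_le_mul' (anti hs ht) (anti (sub_nonneg.2 hsβ) hab)
    · rw [ENNReal.zero_rpow_of_neg (by linarith : -(α + β - s) < 0), ENNReal.mul_top hts]
      exact le_top
  · calc a ^ (-α) * b ^ (-β) = b ^ (-s) * (a ^ (-α) * b ^ (-(β - s))) := by rw [e]; ring
      _ ≤ t ^ (-s) * (a ^ (-α) * a ^ (-(β - s))) := by
        exact mul_le_mul' (anti hs ht) (mul_le_mul' le_rfl (anti (sub_nonneg.2 hsβ) hab))
      _ = _ := by
        rw [← ENNReal.rpow_add _ _ ha0 hat]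
        congr 2
        ring

/-- The larger of |u| and |t - u| is at least |t|/2. That factor gives up s powers to |t|, the
smaller one takes the remaining singularity, and the sum covers both cases. -/
theorem rieszKernel_mul_le {R S α β s : ℝ} (hR : 0 ≤ R) (hS : 0 ≤ S) (hs : 0 ≤ s) (hsα : s ≤ α)
    (hsβ : s ≤ β) (t u : Space3) :
    rieszKernel S β u * rieszKernel R α (t - u) ≤ 2 ^ s * rieszKernel (R + S) s t *
      (rieszKernel (R + S) (α + β - s) u + rieszKernel (R + S) (α + β - s) (t - u)) := by
  rcases lt_or_ge S ‖u‖ with hu | hu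
  · rw [rieszKernel_of_lt hu, zero_mul]
    exact zero_le
  rcases lt_or_ge R ‖t - u‖ with hv | hv
  · rw [rieszKernel_of_lt hv, mul_zero]
    exact zero_le
  have ht : ‖t‖ₑ ≤ ‖t - u‖ₑ + ‖u‖ₑ := by
    simpa using enorm_add_le (t - u) u
  have ht' : ‖t‖ ≤ R + S := by
    have := norm_add_le (t - u) u
    rw [sub_add_cancel] at this
    linarith
  rw [rieszKernel_of_le hu, rieszKernel_of_le hv, rieszKernel_of_le ht',
    rieszKernel_of_le (by linarith : ‖u‖ ≤ R + S),
    rieszKernel_of_le (by linarith : ‖t - u‖ ≤ R + S)]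
  have e : 2 ^ s * ‖t‖ₑ ^ (-s) = (‖t‖ₑ / 2) ^ (-s) := by
    rw [ENNReal.rpow_neg, ENNReal.rpow_neg, ENNReal.div_rpow_of_nonneg _ _ hs,
      ENNReal.inv_div (Or.inl (ENNReal.rpow_ne_top_of_nonneg hs (by simp)))
        (Or.inl (ENNReal.rpow_pos (by simp) (by simp)).ne'), div_eq_mul_inv]
  rw [e]
  rcases le_total ‖u‖ₑ ‖t - u‖ₑ with h | h
  · have h2 : ‖t‖ₑ / 2 ≤ ‖t - u‖ₑ := by
      refine ENNReal.div_le_of_le_mul (ht.trans ?_)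
      rw [mul_two]
      gcongr
    refine (ENNReal.rpow_neg_mul_rpow_neg_le h2 h enorm_ne_top (hs.trans hsβ) hs hsα).trans ?_
    rw [add_comm β α]
    gcongr
    exact le_self_add
  · have h2 : ‖t‖ₑ / 2 ≤ ‖u‖ₑ := by
      refine ENNReal.div_le_of_le_mul (ht.trans ?_)
      rw [mul_two]
      gcongr
    rw [mul_comm]
    refine (ENNReal.rpow_neg_mul_rpow_neg_le h2 h enorm_ne_top (hs.trans hsα) hs hsβ).trans ?_
    gcongr
    exact le_add_self

/-- The composition of two truncated Riesz kernels is bounded by a less singular one. -/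
theorem exists_lintegral_rieszKernel_mul_le {R S α β s : ℝ} (hR : 0 ≤ R) (hS : 0 ≤ S)
    (hs : 0 ≤ s) (hsα : s ≤ α) (hsβ : s ≤ β) (h3 : α + β - s < 3) :
    ∃ C : ℝ≥0∞, C ≠ ⊤ ∧ ∀ x z : Space3,
      ∫⁻ y, rieszKernel S β (y - x) * rieszKernel R α (z - y) ≤
        C * rieszKernel (R + S) s (z - x) := by
  set I := ∫⁻ u, rieszKernel (R + S) (α + β - s) u with hI
  have hI' : I ≠ ⊤ := (lintegral_rieszKernel_lt_top h3 _).ne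
  refine ⟨2 ^ s * (I + I), ENNReal.mul_ne_top (ENNReal.rpow_ne_top_of_nonneg hs (by simp))
    (ENNReal.add_ne_top.2 ⟨hI', hI'⟩), fun x z => ?_⟩
  have hm := measurable_rieszKernel (R + S) (α + β - s)
  have hm' : Measurable fun u => rieszKernel (R + S) (α + β - s) (z - x - u) :=
    hm.comp (measurable_id.const_sub _)
  have hadd : Measurable fun u => rieszKernel (R + S) (α + β - s) u +
      rieszKernel (R + S) (α + β - s) (z - x - u) := hm.add hm'
  calc ∫⁻ y, rieszKernel S β (y - x) * rieszKernel R α (z - y)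
      = ∫⁻ y, (fun u => rieszKernel S β u * rieszKernel R α (z - x - u)) (y - x) := by
        simp only [sub_sub_sub_cancel_right]
    _ = ∫⁻ u, rieszKernel S β u * rieszKernel R α (z - x - u) :=
        lintegral_sub_right_eq_self (μ := volume)
          (fun u => rieszKernel S β u * rieszKernel R α (z - x - u)) x
    _ ≤ ∫⁻ u, 2 ^ s * rieszKernel (R + S) s (z - x) *
          (rieszKernel (R + S) (α + β - s) u + rieszKernel (R + S) (α + β - s) (z - x - u)) :=
        lintegral_mono fun u => rieszKernel_mul_le hR hS hs hsα hsβ _ _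
    _ = 2 ^ s * rieszKernel (R + S) s (z - x) * (I + I) := by
        rw [lintegral_const_mul _ hadd,
          lintegral_add_left hm, lintegral_sub_left_eq_self (μ := volume)
            (rieszKernel (R + S) (α + β - s)) (z - x)]
    _ = _ := by ring

/-- One step of the iteration of an integral inequality with a singular kernel. -/
theorem exists_iterate_rieszKernel {R S β s : ℝ} (hR : 0 ≤ R) (hS : 0 ≤ S)
    (hs : 0 ≤ s) (hs2 : s ≤ 2) (hsβ : s ≤ β) (h3 : 2 + β - s < 3) {M N : ℝ≥0∞} (hM : M ≠ ⊤)
    (hN : N ≠ ⊤) : ∃ C : ℝ≥0∞, C ≠ ⊤ ∧ ∀ (U V : Set Space3) (f : Space3 → ℝ≥0∞),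
      AEMeasurable f → (∀ x ∈ U, closedBall x S ⊆ V) →
      (∀ᵐ x, x ∈ V → f x ≤ M * ∫⁻ y, rieszKernel R 2 (y - x) * f y) →
      (∀ᵐ x, x ∈ U → f x ≤ N * ∫⁻ y, rieszKernel S β (y - x) * f y) →
      ∀ᵐ x, x ∈ U → f x ≤ C * ∫⁻ y, rieszKernel (R + S) s (y - x) * f y := by
  obtain ⟨C, hC, hK⟩ := exists_lintegral_rieszKernel_mul_le (α := 2) hR hS hs hs2 hsβ h3
  refine ⟨N * (M * C), ENNReal.mul_ne_top hN (ENNReal.mul_ne_top hM hC),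
    fun U V f hf hUV hV hU => ?_⟩
  filter_upwards [hU] with x hx hxU
  have hmR := measurable_rieszKernel R 2
  have hmS := measurable_rieszKernel S β
  calc f x ≤ N * ∫⁻ y, rieszKernel S β (y - x) * f y := hx hxU
    _ ≤ N * ∫⁻ y, M * ∫⁻ z, rieszKernel S β (y - x) * rieszKernel R 2 (z - y) * f z := by
        refine mul_le_mul_right (lintegral_mono_ae ?_) _
        filter_upwards [hV] with y hy
        -- Only y within S of x matter, and those lie in V, where the inequality may be substituted.
        rcases lt_or_ge S ‖y - x‖ with hyS | hyS
        · rw [rieszKernel_of_lt hyS, zero_mul]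
          exact zero_le
        · have hyV := hy (hUV x hxU (by simpa [dist_eq_norm] using hyS))
          refine (mul_le_mul_right hyV _).trans_eq ?_
          have hm : AEMeasurable fun z => rieszKernel R 2 (z - y) * f z :=
            (hmR.comp (measurable_id.sub_const y)).aemeasurable.mul hf
          simp only [mul_assoc]
          rw [lintegral_const_mul'' _ hm]
          ring
    _ = N * (M * ∫⁻ z, ∫⁻ y, rieszKernel S β (y - x) * rieszKernel R 2 (z - y) * f z) := by
        rw [lintegral_const_mul' _ _ hM, lintegral_lintegral_swap]
        refine AEMeasurable.mul (Measurable.aemeasurable ?_) hf.comp_snd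
        exact (hmS.comp (measurable_fst.sub_const x)).mul
          (hmR.comp (measurable_snd.sub measurable_fst))
    _ ≤ N * (M * ∫⁻ z, C * (rieszKernel (R + S) s (z - x) * f z)) := by
        refine mul_le_mul_right (mul_le_mul_right (lintegral_mono fun z => ?_) _) _
        have hm : Measurable fun y => rieszKernel S β (y - x) * rieszKernel R 2 (z - y) :=
          (hmS.comp (measurable_id.sub_const x)).mul (hmR.comp (measurable_id.const_sub z))
        rw [lintegral_mul_const _ hm, ← mul_assoc]
        exact mul_le_mul_left (hK x z) _
    _ = _ := by
        rw [lintegral_const_mul' _ _ hC]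
        ring

/-- A function dominated by its own Riesz potential is locally bounded by its integral. -/
theorem exists_le_lintegral_of_le_rieszKernel {R : ℝ} (hR : 0 ≤ R) {M : ℝ≥0∞} (hM : M ≠ ⊤) :
    ∃ C : ℝ≥0∞, C ≠ ⊤ ∧ ∀ (U V : Set Space3) (f : Space3 → ℝ≥0∞),
      AEMeasurable f → (∀ x ∈ U, closedBall x (3 * R) ⊆ V) →
      (∀ᵐ x, x ∈ V → f x ≤ M * ∫⁻ y, rieszKernel R 2 (y - x) * f y) →
      ∀ᵐ x, x ∈ U → f x ≤ C * ∫⁻ y, f y := by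
  -- The condition 2 + β - s < 3 allows a gain strictly below 1 per round, so going from 2 to 0
  -- takes three: 2, 5/4, 1/2, 0. The outer radii are R, 2R, 3R, which accounts for the ball of
  -- radius 3R.
  obtain ⟨C₁, hC₁, h₁⟩ := exists_iterate_rieszKernel (R := R) (S := R) (β := 2) (s := 5 / 4)
    hR hR (by norm_num) (by norm_num) (by norm_num) (by norm_num) hM hM
  obtain ⟨C₂, hC₂, h₂⟩ := exists_iterate_rieszKernel (R := R) (S := R + R) (β := 5 / 4)
    (s := 1 / 2) hR (by linarith) (by norm_num) (by norm_num) (by norm_num) (by norm_num) hM hC₁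
  obtain ⟨C₃, hC₃, h₃⟩ := exists_iterate_rieszKernel (R := R) (S := R + (R + R)) (β := 1 / 2)
    (s := 0) hR (by linarith) (by norm_num) (by norm_num) (by norm_num) (by norm_num) hM hC₂
  refine ⟨C₃, hC₃, fun U V f hf hUV hV => ?_⟩
  have hsub : ∀ r ≤ 3 * R, ∀ x ∈ U, closedBall x r ⊆ V := fun r hr x hx =>
    (closedBall_subset_closedBall hr).trans (hUV x hx)
  have hUV' : U ⊆ V := fun x hx => hUV x hx (mem_closedBall_self (by linarith))
  have h0 : ∀ᵐ x, x ∈ U → f x ≤ M * ∫⁻ y, rieszKernel R 2 (y - x) * f y :=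
    hV.mono fun x hx hxU => hx (hUV' hxU)
  have := h₃ U V f hf (hsub _ (by linarith)) hV (h₂ U V f hf (hsub _ (by linarith)) hV
    (h₁ U V f hf (hsub _ (by linarith)) hV h0))
  filter_upwards [this] with x hx hxU
  refine (hx hxU).trans (mul_le_mul_right (lintegral_mono fun y => ?_) _)
  refine mul_le_of_le_one_left zero_le ?_
  rw [rieszKernel, neg_zero]
  simp only [ENNReal.rpow_zero]
  exact Set.indicator_le_self' (fun _ _ => zero_le) _

/-- Absolute continuity of the integral. This smallness later gives uniform Cauchy estimates once
`g` is locally bounded. -/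
theorem tendsto_lintegral_rieszKernel {α : ℝ} (hα : α < 3) :
    Tendsto (fun r => ∫⁻ z, rieszKernel r α z) (𝓝[>] 0) (𝓝 0) := by
  have hvol : Tendsto (fun r : ℝ => volume (closedBall (0 : Space3) r)) (𝓝[>] 0) (𝓝 0) := by
    have h1 : Tendsto (fun r : ℝ => ENNReal.ofReal (r ^ 3) * volume (closedBall (0 : Space3) 1))
        (𝓝[>] 0) (𝓝 (ENNReal.ofReal (0 ^ 3) * volume (closedBall (0 : Space3) 1))) := by
      refine ENNReal.Tendsto.mul_const ?_ (Or.inr measure_closedBall_lt_top.ne)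
      exact ((ENNReal.continuous_ofReal.comp (continuous_pow 3)).tendsto 0).mono_left
        nhdsWithin_le_nhds
    simp only [ne_eq, OfNat.ofNat_ne_zero, not_false_eq_true, zero_pow, ENNReal.ofReal_zero,
      zero_mul] at h1
    refine h1.congr' ?_
    filter_upwards [self_mem_nhdsWithin] with r (hr : 0 < r)
    rw [Measure.addHaar_closedBall' _ _ hr.le]
    simp
  refine (tendsto_setLIntegral_zero (lintegral_rieszKernel_lt_top hα 1).ne hvol).congr' ?_
  filter_upwards [Ioc_mem_nhdsGT (zero_lt_one' ℝ)] with r hr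
  rw [rieszKernel, rieszKernel, setLIntegral_indicator measurableSet_closedBall,
    lintegral_indicator measurableSet_closedBall,
    Set.inter_eq_self_of_subset_right (closedBall_subset_closedBall hr.2)]

/-! ### Functions satisfying the mollification estimate -/

section Core

variable {E : Type*} [NormedAddCommGroup E] [NormedSpace ℝ E]

/-- The differences of mollifications of `g` are controlled on `G` by a truncated Riesz potential
of `‖g‖`. -/
def MollifyEstimate (G : Set Space3) (P : ℝ≥0∞) (g : Space3 → E) : Prop :=
  ∀ ε δ R : ℝ, 0 < ε → 0 < δ → ε ≤ R → δ ≤ R → ∀ x, closedBall x R ⊆ G →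
    ‖mollify ε g x - mollify δ g x‖ₑ ≤ P * ∫⁻ y, rieszKernel R 2 (y - x) * ‖g y‖ₑ

/-- Fixing δ = R and letting ε → 0 shows that |g| is dominated by its own Riesz potential. The
constant is chosen before `g`, hence is uniform over all solutions. -/
theorem exists_ae_enorm_le_lintegral [CompleteSpace E] (G : Set Space3) {P : ℝ≥0∞} (hP : P ≠ ⊤)
    {R : ℝ} (hR : 0 < R) : ∃ C : ℝ≥0∞, C ≠ ⊤ ∧ ∀ (U : Set Space3) (g : Space3 → E),
      Integrable g → MollifyEstimate G P g → (∀ x ∈ U, closedBall x (4 * R) ⊆ G) →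
      ∀ᵐ x, x ∈ U → ‖g x‖ₑ ≤ C * ∫⁻ y, ‖g y‖ₑ := by
  obtain ⟨B, hB, hBx⟩ := exists_enorm_mollify_le (E := E) hR
  have hm0 : ‖mollMass‖ₑ ≠ 0 := enorm_ne_zero.2 mollMass_pos.ne'
  obtain ⟨C, hC, h⟩ := exists_le_lintegral_of_le_rieszKernel hR.le
    (M := (P + B) / ‖mollMass‖ₑ) (ENNReal.div_ne_top (ENNReal.add_ne_top.2 ⟨hP, hB⟩) hm0)
  refine ⟨C, hC, fun U g hg hest hU => h U {x | closedBall x R ⊆ G} (fun x => ‖g x‖ₑ)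
    hg.aestronglyMeasurable.enorm (fun x hx y hy => ?_) ?_⟩
  -- The iteration needs radius 3R around points of U and one more R for the inequality itself, in
  -- total 4R.
  · refine (closedBall_subset_closedBall' ?_).trans (hU x hx)
    linarith [mem_closedBall.1 hy]
  · filter_upwards [ae_tendsto_mollify hg] with x hx hxV
    set I := ∫⁻ y, rieszKernel R 2 (y - x) * ‖g y‖ₑ with hI
    have hle : ‖mollMass • g x‖ₑ ≤ (P + B) * I := by
      refine le_of_tendsto hx.enorm ?_
      filter_upwards [Ioc_mem_nhdsGT hR] with ε hε
      have h1 := hest ε R R hε.1 hR hε.2 le_rfl x hxV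
      have h2 := hBx g x
      rw [setLIntegral_closedBall_eq_rieszKernel R 2 (fun y => ‖g y‖ₑ) x] at h2
      calc ‖mollify ε g x‖ₑ = ‖(mollify ε g x - mollify R g x) + mollify R g x‖ₑ := by
            rw [sub_add_cancel]
        _ ≤ P * I + B * I := (enorm_add_le _ _).trans (add_le_add h1 h2)
        _ = (P + B) * I := by ring
    rw [enorm_smul, mul_comm] at hle
    calc ‖g x‖ₑ ≤ (P + B) * I / ‖mollMass‖ₑ :=
          (ENNReal.le_div_iff_mul_le (Or.inl hm0) (Or.inl enorm_ne_top)).2 hle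
      _ = (P + B) / ‖mollMass‖ₑ * I := by
        rw [div_eq_mul_inv, div_eq_mul_inv]
        ring

theorem IsCompact.exists_closedBall_thickening_subset {X : Type*} [PseudoMetricSpace X]
    {K G : Set X} (hK : IsCompact K) (hG : IsOpen G) (hKG : K ⊆ G) :
    ∃ R : ℝ, 0 < R ∧ ∀ x ∈ thickening R K, closedBall x (4 * R) ⊆ G := by
  obtain ⟨d, hd, hdG⟩ := hK.exists_thickening_subset_open hG hKG
  -- The distance to K is below R + 4R = 5d/8 < d.
  refine ⟨d / 8, by positivity, fun x hx y hy => hdG ?_⟩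
  obtain ⟨z, hz, hxz⟩ := mem_thickening_iff.1 hx
  refine mem_thickening_iff.2 ⟨z, hz, ?_⟩
  linarith [dist_triangle y x z, mem_closedBall.1 hy]

theorem uniformCauchySeqOn_mollify [CompleteSpace E] {G : Set Space3} (hG : IsOpen G) {P : ℝ≥0∞}
    (hP : P ≠ ⊤) {g : Space3 → E} (hg : Integrable g) (hest : MollifyEstimate G P g)
    {K : Set Space3} (hK : IsCompact K) (hKG : K ⊆ G) :
    UniformCauchySeqOn (fun ε => mollify ε g) (𝓝[>] 0) K := by
  obtain ⟨R, hR, hRG⟩ := hK.exists_closedBall_thickening_subset hG hKG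
  obtain ⟨C, hC, h⟩ := exists_ae_enorm_le_lintegral (E := E) G hP hR
  have hL := h (thickening R K) g hg hest hRG
  set L := C * ∫⁻ y, ‖g y‖ₑ with hLdef
  have hLtop : L ≠ ⊤ := ENNReal.mul_ne_top hC hg.hasFiniteIntegral.ne
  have hlim : Tendsto (fun r => P * L * ∫⁻ z, rieszKernel r 2 z) (𝓝[>] 0) (𝓝 0) := by
    simpa using ENNReal.Tendsto.const_mul (tendsto_lintegral_rieszKernel (α := 2) (by norm_num))
      (Or.inr (ENNReal.mul_ne_top hP hLtop))
  intro u hu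
  obtain ⟨η, hη, hηu⟩ := mem_uniformity_edist.1 hu
  obtain ⟨r, hr, hrR⟩ := ((hlim.eventually (gt_mem_nhds hη)).and
    (Ioo_mem_nhdsGT hR)).exists
  have hev : ∀ᶠ ε in 𝓝[>] (0 : ℝ), ε ∈ Set.Ioc 0 r := Ioc_mem_nhdsGT hrR.1
  filter_upwards [hev.prod_mk hev] with n hn x hx
  refine hηu ?_
  rw [edist_eq_enorm_sub]
  have hball : closedBall x r ⊆ thickening R K := fun y hy =>
    mem_thickening_iff.2 ⟨x, hx, (mem_closedBall.1 hy).trans_lt hrR.2⟩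
  refine (hest n.1 n.2 r hn.1.1 hn.2.1 hn.1.2 hn.2.2 x (hball.trans fun y hy =>
    hRG y hy (mem_closedBall_self (by positivity)))).trans_lt (lt_of_le_of_lt ?_ hr)
  -- The bound L on |g| near K leaves L times the kernel's mass, which by translation invariance
  -- does not depend on x.
  calc P * ∫⁻ y, rieszKernel r 2 (y - x) * ‖g y‖ₑ
      ≤ P * ∫⁻ y, L * rieszKernel r 2 (y - x) := by
        refine mul_le_mul_right (lintegral_mono_ae ?_) _
        filter_upwards [hL] with y hy
        rcases lt_or_ge r ‖y - x‖ with hyr | hyr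
        · rw [rieszKernel_of_lt hyr, zero_mul]
          exact zero_le
        · rw [mul_comm]
          exact mul_le_mul_left (hy (hball (by simpa [dist_eq_norm] using hyr))) _
    _ = _ := by
        rw [lintegral_const_mul' _ _ hLtop, lintegral_sub_right_eq_self (μ := volume)
          (rieszKernel r 2) x, ← mul_assoc]

theorem exists_continuousOn_ae_eq [CompleteSpace E] {G : Set Space3} (hG : IsOpen G) {P : ℝ≥0∞}
    (hP : P ≠ ⊤) {g : Space3 → E} (hg : Integrable g) (hest : MollifyEstimate G P g) :
    ∃ u : Space3 → E, ContinuousOn u G ∧ u =ᵐ[volume.restrict G] g := by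
  have hpt : ∀ x ∈ G, ∃ l, Tendsto (fun ε => mollify ε g x) (𝓝[>] 0) (𝓝 l) := fun x hx =>
    cauchy_map_iff_exists_tendsto.1 ((uniformCauchySeqOn_mollify hG hP hg hest isCompact_singleton
      (Set.singleton_subset_iff.2 hx)).cauchy_map rfl)
  choose! l hl using hpt
  have hloc : TendstoLocallyUniformlyOn (fun ε => mollify ε g) l (𝓝[>] 0) G := by
    rw [tendstoLocallyUniformlyOn_iff_forall_isCompact hG]
    exact fun K hKG hK => (uniformCauchySeqOn_mollify hG hP hg hest hK
      hKG).tendstoUniformlyOn_of_tendsto fun x hx => hl x (hKG hx)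
  have hcont : ContinuousOn l G := by
    refine hloc.continuousOn (Eventually.frequently ?_)
    filter_upwards [self_mem_nhdsWithin] with ε hε using (continuous_mollify hε hg).continuousOn
  refine ⟨fun x => mollMass⁻¹ • l x, hcont.const_smul _, ?_⟩
  filter_upwards [ae_restrict_of_ae (ae_tendsto_mollify hg), ae_restrict_mem hG.measurableSet]
    with x hx hxG
  rw [tendsto_nhds_unique (hl x hxG) hx, inv_smul_smul₀ mollMass_pos.ne']

end Core

/-- A violation at one point would persist on a neighbourhood, but a set of full measure is dense.
-/
theorem ContinuousOn.enorm_le_of_ae_le {X E : Type*} [TopologicalSpace X] [MeasurableSpace X]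
    {μ : Measure X} [μ.IsOpenPosMeasure] [NormedAddCommGroup E] {u : X → E} {U : Set X}
    (hu : ContinuousOn u U) (hU : IsOpen U) {B : ℝ≥0∞} (h : ∀ᵐ x ∂μ, x ∈ U → ‖u x‖ₑ ≤ B)
    {x : X} (hx : x ∈ U) : ‖u x‖ₑ ≤ B := by
  by_contra! hlt
  have h1 : ∀ᶠ y in 𝓝 x, B < ‖u y‖ₑ :=
    (hu.continuousAt (hU.mem_nhds hx)).enorm.eventually (lt_mem_nhds hlt)
  have h2 : ∃ᶠ y in 𝓝 x, y ∈ U → ‖u y‖ₑ ≤ B :=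
    mem_closure_iff_frequently.1 (Measure.dense_of_ae h x)
  obtain ⟨y, hy, hy', hyU⟩ := (h2.and_eventually (h1.and (hU.mem_nhds hx))).exists
  exact absurd (hy hyU) (not_le.2 hy')

/-! ### Vekua-Bergman functions -/

section VekuaBergman

variable {G : Set Space3} {A : Fin 4 → Space3 → ℍ[ℂ]} {p : ℝ≥0∞}

/-- The extension by zero of the conjugate of `w`. -/
def conjExt (G : Set Space3) (w : Space3 → ℍ[ℂ]) : Space3 → ℍ[ℂ] := G.indicator fun y => star (w y)

theorem integrable_conjExt (hG : MeasurableSet G) {w : Space3 → ℍ[ℂ]} (hw : IntegrableOn w G) :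
    Integrable (conjExt G w) :=
  (integrable_indicator_iff hG).2 (biqStar.toContinuousLinearMap.integrable_comp hw)

theorem lintegral_enorm_conjExt (hG : MeasurableSet G) (w : Space3 → ℍ[ℂ]) :
    ∫⁻ y, ‖conjExt G w y‖ₑ = ∫⁻ y in G, ‖w y‖ₑ := by
  simp only [conjExt, enorm_indicator_eq_indicator_enorm]
  rw [lintegral_indicator hG]
  simp only [enorm_biq_star]

theorem integrableOn_of_Lp (hG_bdd : Bornology.IsBounded G) (hp : 1 ≤ p)
    (w : Lp ℍ[ℂ] p (volume.restrict G)) : IntegrableOn w G := by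
  have : IsFiniteMeasure (volume.restrict G) := ⟨by
    simpa using hG_bdd.measure_lt_top⟩
  exact memLp_one_iff_integrable.1 ((Lp.memLp w).mono_exponent hp)

theorem mollifyEstimate_conjExt (hG : MeasurableSet G) {w : Space3 → ℍ[ℂ]}
    (hw : IntegrableOn w G) (h : HasWeakDiracDeriv G w (vekuaQ A w))
    (hA : ∀ j, MemLp (A j) ⊤ (volume.restrict G)) :
    MollifyEstimate G
      (‖biqMul‖ₑ * (‖biqMul‖ₑ * ∑ j, eLpNorm (A j) ⊤ (volume.restrict G))) (conjExt G w) :=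
  fun ε δ R hε hδ hεR hδR x hx => by
    have := enorm_mollify_sub_le hG h hw (ENNReal.mul_ne_top enorm_ne_top
      (ENNReal.sum_ne_top.2 fun j _ => (hA j).2.ne)) (enorm_vekuaQ_le A w) hε hδ hεR hδR hx
    rwa [setLIntegral_closedBall_eq_rieszKernel R 2
      (fun y => ‖G.indicator (fun y => star (w y)) y‖ₑ) x] at this

theorem lintegral_enorm_le_norm_Lp (hp : 1 ≤ p) (w : Lp ℍ[ℂ] p (volume.restrict G)) :
    ∫⁻ y in G, ‖w y‖ₑ ≤ ENNReal.ofReal ‖w‖ * volume G ^ (1 - 1 / p.toReal) := by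
  have h := eLpNorm_le_eLpNorm_mul_rpow_measure_univ hp (Lp.aestronglyMeasurable w)
  rw [eLpNorm_one_eq_lintegral_enorm] at h
  refine h.trans_eq ?_
  rw [Lp.norm_def, ENNReal.ofReal_toReal (Lp.eLpNorm_ne_top w)]
  simp

end VekuaBergman

end

theorem mainTheorem1 (G : Set (EuclideanSpace ℝ (Fin 3))) (hG_open : IsOpen G)
    (hG_conn : IsConnected G) (hG_bdd : Bornology.IsBounded G)
    (A : Fin 4 → EuclideanSpace ℝ (Fin 3) → ℍ[ℂ])
    (hA : ∀ j, MemLp (A j) ⊤ (volume.restrict G))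
    (p : ℝ≥0∞) (hp : 3 / 2 < p) (hp_top : p < ⊤) :
    (∀ w ∈ vekuaBergman p G A, ∃ u : EuclideanSpace ℝ (Fin 3) → ℍ[ℂ],
      ContinuousOn u G ∧ u =ᵐ[volume.restrict G] w) ∧
    ∀ K : Set (EuclideanSpace ℝ (Fin 3)), IsCompact K → K ⊆ G →
      ∃ C : ℝ, 0 < C ∧ ∀ w ∈ vekuaBergman p G A, ∀ u : EuclideanSpace ℝ (Fin 3) → ℍ[ℂ],
        ContinuousOn u G → u =ᵐ[volume.restrict G] w → ∀ x ∈ K, ‖u x‖ ≤ C * ‖w‖ := by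
  have hp1 : 1 ≤ p := by
    refine le_trans ?_ hp.le
    rw [ENNReal.le_div_iff_mul_le (by simp) (by simp)]
    norm_num
  have hGm := hG_open.measurableSet
  have hP : ‖biqMul‖ₑ * (‖biqMul‖ₑ * ∑ j, eLpNorm (A j) ⊤ (volume.restrict G)) ≠ ⊤ :=
    ENNReal.mul_ne_top enorm_ne_top (ENNReal.mul_ne_top enorm_ne_top
      (ENNReal.sum_ne_top.2 fun j _ => (hA j).2.ne))
  refine ⟨fun w hw => ?_, fun K hK hKG => ?_⟩
  · have hwi := integrableOn_of_Lp hG_bdd hp1 w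
    obtain ⟨u, hu, huw⟩ := exists_continuousOn_ae_eq hG_open hP (integrable_conjExt hGm hwi)
      (mollifyEstimate_conjExt hGm hwi hw hA)
    refine ⟨fun x => star (u x), biqStar.continuous.comp_continuousOn hu, ?_⟩
    filter_upwards [huw, ae_restrict_mem hGm] with x hx hxG
    rw [hx, conjExt, Set.indicator_of_mem hxG, star_star]
  · obtain ⟨R, hR, hRG⟩ := hK.exists_closedBall_thickening_subset hG_open hKG
    obtain ⟨C, hC, h⟩ := exists_ae_enorm_le_lintegral (E := ℍ[ℂ]) G hP hR
    have hvol : volume G ^ (1 - 1 / p.toReal) ≠ ⊤ := by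
      refine ENNReal.rpow_ne_top_of_nonneg ?_ hG_bdd.measure_lt_top.ne
      have : 1 ≤ p.toReal := (ENNReal.toReal_le_toReal (by simp) hp_top.ne).2 hp1
      rw [sub_nonneg]
      exact div_le_one_of_le₀ this (by linarith)
    set D := C * volume G ^ (1 - 1 / p.toReal) with hD
    have hDtop : D ≠ ⊤ := ENNReal.mul_ne_top hC hvol
    -- The added 1 only ensures positivity of the constant.
    refine ⟨D.toReal + 1, by positivity, fun w hw u hu huw x hx => ?_⟩
    have hwi := integrableOn_of_Lp hG_bdd hp1 w
    have hUG : thickening R K ⊆ G := fun y hy => hRG y hy (mem_closedBall_self (by positivity))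
    have hae : ∀ᵐ y, y ∈ thickening R K → ‖u y‖ₑ ≤ D * ENNReal.ofReal ‖w‖ := by
      filter_upwards [h (thickening R K) _ (integrable_conjExt hGm hwi)
        (mollifyEstimate_conjExt hGm hwi hw hA) hRG, (ae_restrict_iff' hGm).1 huw] with y hy hyw hyU
      have h1 := hy hyU
      rw [lintegral_enorm_conjExt hGm, conjExt, Set.indicator_of_mem (hUG hyU), enorm_biq_star,
        ← hyw (hUG hyU)] at h1
      calc ‖u y‖ₑ ≤ C * (ENNReal.ofReal ‖w‖ * volume G ^ (1 - 1 / p.toReal)) :=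
            h1.trans (mul_le_mul_right (lintegral_enorm_le_norm_Lp hp1 w) _)
        _ = _ := by rw [hD]; ring
    have hle := (hu.mono hUG).enorm_le_of_ae_le isOpen_thickening hae
      (self_subset_thickening hR K hx)
    have hw0 : 0 ≤ ‖w‖ := by
      rw [Lp.norm_def]
      exact ENNReal.toReal_nonneg
    have hreal := ENNReal.toReal_mono (ENNReal.mul_ne_top hDtop ENNReal.ofReal_ne_top) hle
    rw [toReal_enorm, ENNReal.toReal_mul, ENNReal.toReal_ofReal hw0] at hreal
    linarith
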